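/- Let $p$ be a prime and let $k$ be a perfect field of characteristic $p$. For an $\mathbb{F}_p$-scheme $X$ and an integer $n\ge 1$, let $W_n\mathcal{O}_X$ be the sheaf of rings $U\mapsto W_n(\mathcal{O}_X(U))$ of $p$-typical Witt vectors of length $n$, with Frobenius $F\colon W_n\mathcal{O}_X\to F_*W_n\mathcal{O}_X$ (raising each Witt component to the $p$-th power) and restriction $R^{n-1}\colon W_n\mathcal{O}_X\to\mathcal{O}_X$ (the zeroth Witt component). The scheme $X$ is called *$n$-quasi-$F$-split* if there is a morphism $\sigma\colon F_*W_n\mathcal{O}_X\to\mathcal{O}_X$ of $W_n\mathcal{O}_X$-modules with $\sigma\circ F=R^{n-1}$, where $\mathcal{O}_X$ is a $W_n\mathcal{O}_X$-module via $R^{n-1}$. It is called *$F$-split* if there is a morphism $\sigma\colon F_*\mathcal{O}_X\to\mathcal{O}_X$ of $\mathcal{O}_X$-modules with $\sigma\circ F=\mathrm{id}_{\mathcal{O}_X}$, where $F\colon\mathcal{O}_X\to F_*\mathcal{O}_X$ is the $p$-power Frobenius. Let $X$ and $Y$ be arbitrary schemes over $k$ and let $n\ge 1$ be an integer. If $X$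 is $F$-split and $Y$ is $n$-quasi-$F$-split, then $X\times_k Y$ is $n$-quasi-$F$-split. -/

import Mathlib

open CategoryTheory AlgebraicGeometry

universe u

namespace QuasiFSplit

/-- The map `W_n(R) → W_n(S)` of truncated `p`-typical Witt vectors,
given by applying `f : R → S` to every Witt component. -/
def wittMap (p n : ℕ) {R S : Type*} [CommRing R] [CommRing S] (f : R →+* S)
    (x : TruncatedWittVector p n R) : TruncatedWittVector p n S :=
  TruncatedWittVector.mk p fun i => f (x.coeff i)

/-- The Frobenius `F : W_n(R) → W_n(R)` of the truncated Witt vectors of an `𝔽_p`-algebra `R`.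
It is induced by the `p`-power map of `R`, hence raises every Witt component to the `p`-th power. -/
def wittFrobenius (p n : ℕ) {R : Type*} [CommRing R]
    (x : TruncatedWittVector p n R) : TruncatedWittVector p n R :=
  TruncatedWittVector.mk p fun i => x.coeff i ^ p

/-- The map `W_n(R) → W_n(S)` is the one induced by the functoriality of `W`. -/
theorem wittMap_truncate (p n : ℕ) [Fact p.Prime] {R S : Type*} [CommRing R] [CommRing S]
    (f : R →+* S) (x : WittVector p R) :
    wittMap p n f (WittVector.truncate n x) = WittVector.truncate n (WittVector.map f x) := by
  ext i
  simp [wittMap]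

/-- If `p = 0` in `R`, then `F` on `W_n(R)` is induced by the Witt vector Frobenius on `W(R)`. -/
theorem wittFrobenius_truncate (p n : ℕ) [Fact p.Prime] {R : Type*} [CommRing R]
    (hR : (p : R) = 0) (x : WittVector p R) :
    wittFrobenius p n (WittVector.truncate n x) =
      WittVector.truncate n (WittVector.frobenius x) := by
  rcases subsingleton_or_nontrivial R with h | h
  · ext i
    exact Subsingleton.elim _ _
  · have : CharP R p := (CharP.charP_iff_prime_eq_zero Fact.out).2 hR
    ext i
    simp [wittFrobenius, WittVector.coeff_frobenius_charP]

/-- `X` is an `𝔽_p`-scheme, i.e. `p = 0` in `𝒪_X`. -/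
def IsFpScheme (p : ℕ) (X : Scheme.{u}) : Prop := (p : Γ(X, ⊤)) = 0

/-- An `F`-splitting of an `𝔽_p`-scheme `X`: a morphism `σ : F_* 𝒪_X → 𝒪_X` of sheaves of
`𝒪_X`-modules with `σ ∘ F = id`. As `F` is the identity on the underlying space,
`(F_* 𝒪_X)(U)` is the additive group `𝒪_X(U)`, on which `a ∈ 𝒪_X(U)` acts by `b ↦ a ^ p * b`. -/
structure FSplitting (p : ℕ) (X : Scheme.{u}) where
  /-- The additive map on sections over `U`. -/
  app (U : X.Opens) : Γ(X, U) →+ Γ(X, U)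
  /-- Compatibility with restriction to smaller open sets. -/
  naturality {U V : X.Opens} (i : U ⟶ V) (b : Γ(X, V)) :
    app U ((X.presheaf.map i.op).hom b) = (X.presheaf.map i.op).hom (app V b)
  /-- Linearity over `𝒪_X`. -/
  map_smul (U : X.Opens) (a b : Γ(X, U)) : app U (a ^ p * b) = a * app U b
  /-- `σ ∘ F = id`. -/
  comp_frobenius (U : X.Opens) (a : Γ(X, U)) : app U (a ^ p) = a

/-- `X` is an `F`-split `𝔽_p`-scheme. -/
def IsFSplit (p : ℕ) (X : Scheme.{u}) : Prop :=
  IsFpScheme p X ∧ Nonempty (FSplitting p X)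

/-- An `n`-quasi-`F`-splitting of an `𝔽_p`-scheme `X`, for `n ≥ 1`: a morphism
`σ : F_* W_n 𝒪_X → 𝒪_X` of sheaves of `W_n 𝒪_X`-modules with `σ ∘ F = R ^ (n - 1)`.

Here `W_n 𝒪_X` is the sheaf of rings `U ↦ W_n(𝒪_X(U))`, it acts on `𝒪_X` through the
restriction `R ^ (n - 1) : W_n 𝒪_X → 𝒪_X`, which takes a Witt vector to its zeroth component,
and `(F_* W_n 𝒪_X)(U)` is the additive group `W_n(𝒪_X(U))`, on which `a ∈ W_n(𝒪_X(U))` acts by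
`b ↦ F(a) * b`. -/
structure QuasiFSplitting (p n : ℕ) [Fact p.Prime] [NeZero n] (X : Scheme.{u}) where
  /-- The additive map on sections over `U`. -/
  app (U : X.Opens) : TruncatedWittVector p n Γ(X, U) →+ Γ(X, U)
  /-- Compatibility with restriction to smaller open sets. -/
  naturality {U V : X.Opens} (i : U ⟶ V) (b : TruncatedWittVector p n Γ(X, V)) :
    app U (wittMap p n (X.presheaf.map i.op).hom b) = (X.presheaf.map i.op).hom (app V b)
  /-- Linearity over `W_n 𝒪_X`. -/
  map_smul (U : X.Opens) (a b : TruncatedWittVector p n Γ(X, U)) :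
    app U (wittFrobenius p n a * b) = a.coeff 0 * app U b
  /-- `σ ∘ F = R ^ (n - 1)`. -/
  comp_frobenius (U : X.Opens) (a : TruncatedWittVector p n Γ(X, U)) :
    app U (wittFrobenius p n a) = a.coeff 0

/-- `X` is an `n`-quasi-`F`-split `𝔽_p`-scheme. -/
def IsQuasiFSplit (p n : ℕ) [Fact p.Prime] [NeZero n] (X : Scheme.{u}) : Prop :=
  IsFpScheme p X ∧ Nonempty (QuasiFSplitting p n X)

end QuasiFSplit

/-!
Let `σ` be an `F`-splitting of `X` and `τ` an `n`-quasi-`F`-splitting of `Y`.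

For `k`-algebras `A` and `B` with splittings `σ` and `τ`, iterating `σ` gives an `A`-linear
retraction of `A → A_perf`. If `P` is a perfect `k`-algebra with basis `e`, then all the families
`e i ^ (p ^ m)` are bases as well, and so every element of `W_n(B ⊗ P)` is uniquely a sum of
elements `[e i] * w i` with `w i ∈ W_n(B)`
(`truncate_eq_zero_of_teichmullerSum`, `exists_truncate_sub_teichmullerSum`). For `P = A_perf` one
can therefore define an additive map on `W_n(B ⊗ P)` which sends `[z] * w` to
`(retraction of z ^ (1 / p)) ⊗ τ w`. Restricted to `W_n(A ⊗ B)` it is a quasi-`F`-splitting `Φ`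
with `Φ (V ^ m [a ⊗ b]) = σ ^ (m + 1) a ⊗ τ (V ^ m [b])`
(`RingQuasiFSplitting.exists_tensor`). Throughout, linearity only has to be checked for
Teichmüller representatives: `F V = p`, and `p` acts as zero on the target.

Quasi-`F`-splittings of rings extend to localizations (`RingQuasiFSplitting.exists_localization`),
so that every local ring of `X ×ₖ Y` acquires a splitting `Φ x`. It is characterized by its values
on the elements `V ^ m [c ^ (p ^ (m + 1)) * a * b]`, where `a` and `b` are germs of sections of `X`
and `Y` (`IsProductAt`). These elements generate the Witt vectors of the sections over small open
sets (`closure_sections_basicOpen`, `exists_mem_closure_iterate_verschiebung`), and on each of them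
the formula for `Φ x` is the germ of one section which does not depend on `x`
(`exists_local_section`). Hence the maps `Φ x` glue to a morphism of sheaves
(`nonempty_quasiFSplitting_of_stalks`).
-/

namespace QuasiFSplit

open WittVector TensorProduct

/-! ### Witt vectors modulo powers of the Verschiebung -/

section Witt

variable {p : ℕ} [hp : Fact p.Prime] {R S : Type*} [CommRing R] [CommRing S]

theorem truncate_eq_zero_iff {n : ℕ} {x : WittVector p R} :
    truncate n x = 0 ↔ ∀ i < n, x.coeff i = 0 := by
  rw [← mem_ker_truncate, RingHom.mem_ker]

theorem truncate_map_eq_zero {n : ℕ} (f : R →+* S) {x : WittVector p R}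
    (hx : truncate n x = 0) : truncate n (WittVector.map f x) = 0 := by
  rw [truncate_eq_zero_iff] at hx ⊢
  intro i hi
  simp [map_coeff, hx i hi]

theorem exists_iterate_verschiebung {n : ℕ} {x : WittVector p R} (hx : truncate n x = 0) :
    ∃ y, x = verschiebung^[n] y :=
  ⟨_, eq_iterate_verschiebung (truncate_eq_zero_iff.1 hx)⟩

theorem exists_verschiebung {x : WittVector p R} (hx : x.coeff 0 = 0) :
    ∃ y, x = verschiebung y :=
  exists_iterate_verschiebung (n := 1) (truncate_eq_zero_iff.2 fun i hi => by
    rwa [Nat.lt_one_iff.1 hi])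

theorem truncate_verschiebung_eq_zero_iff {n : ℕ} {x : WittVector p R} :
    truncate (n + 1) (verschiebung x) = 0 ↔ truncate n x = 0 := by
  simp only [truncate_eq_zero_iff]
  refine ⟨fun h i hi => by simpa using h (i + 1) (by omega), fun h i hi => ?_⟩
  cases i with
  | zero => simp
  | succ i => simpa using h i (by omega)

theorem truncate_iterate_verschiebung (n : ℕ) (x : WittVector p R) :
    truncate n (verschiebung^[n] x) = 0 :=
  truncate_eq_zero_iff.2 fun _ hi => iterate_verschiebung_coeff_eq_zero x hi

theorem map_iterate_verschiebung (f : R →+* S) (m : ℕ) (x : WittVector p R) :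
    WittVector.map f (verschiebung^[m] x) = verschiebung^[m] (WittVector.map f x) := by
  induction m with
  | zero => rfl
  | succ m ih => rw [Function.iterate_succ_apply', map_verschiebung, ih,
      Function.iterate_succ_apply']

section CharP

variable [CharP R p]

theorem frobenius_teichmuller (a : R) :
    frobenius (teichmuller p a) = teichmuller p (a ^ p) := by
  rw [frobenius_eq_map_frobenius, map_teichmuller, frobenius_def]

theorem iterate_frobenius_teichmuller (m : ℕ) (a : R) :
    frobenius^[m] (teichmuller p a) = teichmuller p (a ^ p ^ m) := by
  induction m with
  | zero => simp
  | succ m ih => rw [Function.iterate_succ_apply', ih, frobenius_teichmuller, ← pow_mul, pow_succ]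

theorem teichmuller_mul_verschiebung (a : R) (x : WittVector p R) :
    teichmuller p a * verschiebung x = verschiebung (teichmuller p (a ^ p) * x) := by
  rw [mul_comm, ← verschiebung_mul_frobenius, frobenius_teichmuller, mul_comm]

theorem teichmuller_mul_iterate_verschiebung (m : ℕ) (a : R) (x : WittVector p R) :
    teichmuller p a * verschiebung^[m] x =
      verschiebung^[m] (teichmuller p (a ^ p ^ m) * x) := by
  rw [mul_comm, iterate_verschiebung_mul_left, iterate_frobenius_teichmuller, mul_comm]

/-- Modulo `p`, the Frobenius of a Witt vector depends on its zeroth component only, because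
`F V = p`. -/
theorem exists_frobenius_mul_eq (z y : WittVector p R) :
    ∃ t, frobenius z * y = teichmuller p (z.coeff 0 ^ p) * y + p * t := by
  obtain ⟨w, hw⟩ := exists_verschiebung (x := z - teichmuller p (z.coeff 0)) (by
    rw [← constantCoeff_apply, map_sub]; simp)
  refine ⟨w * y, ?_⟩
  rw [← frobenius_teichmuller, ← sub_eq_iff_eq_add', ← sub_mul, ← map_sub, hw,
    frobenius_verschiebung]
  ring

end CharP

/-- If `T m` generates the additive group of `R` for every `m`, then the `V ^ m [t]` with
`t ∈ T m` generate the additive group of `W_n(R)`. -/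
theorem exists_mem_closure_iterate_verschiebung (T : ℕ → Set R)
    (hT : ∀ m, AddSubgroup.closure (T m) = ⊤) (n : ℕ) (x : WittVector p R) :
    ∃ g ∈ AddSubgroup.closure {y | ∃ m, ∃ t ∈ T m, y = verschiebung^[m] (teichmuller p t)},
      truncate n (x - g) = 0 := by
  induction n with
  | zero => exact ⟨0, zero_mem _, truncate_eq_zero_iff.2 fun _ hi => absurd hi (Nat.not_lt_zero _)⟩
  | succ n ih =>
    obtain ⟨g, hg, hxg⟩ := ih
    obtain ⟨y, hy⟩ := exists_iterate_verschiebung hxg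
    -- Write `x - g = V ^ n y` and correct the zeroth component of `y`.
    have key : ∀ d ∈ AddSubgroup.closure (T n), ∃ h : WittVector p R, h.coeff 0 = d ∧
        verschiebung^[n] h ∈ AddSubgroup.closure
          {y | ∃ m, ∃ t ∈ T m, y = verschiebung^[m] (teichmuller p t)} := by
      intro d hd
      induction hd using AddSubgroup.closure_induction with
      | mem t ht => exact ⟨teichmuller p t, by simp, AddSubgroup.subset_closure ⟨n, t, ht, rfl⟩⟩
      | zero => exact ⟨0, by simp, by rw [iterate_map_zero]; exact zero_mem _⟩
      | add a b _ _ ha hb =>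
        obtain ⟨h, h0, hh⟩ := ha
        obtain ⟨h', h0', hh'⟩ := hb
        refine ⟨h + h', ?_, by rw [iterate_map_add]; exact add_mem hh hh'⟩
        rw [← constantCoeff_apply, map_add]
        simp [h0, h0']
      | neg a _ ha =>
        obtain ⟨h, h0, hh⟩ := ha
        refine ⟨-h, ?_, by rw [iterate_map_neg]; exact neg_mem hh⟩
        rw [← constantCoeff_apply, map_neg]
        simp [h0]
    obtain ⟨h, h0, hh⟩ := key (y.coeff 0) (by rw [hT]; trivial)
    obtain ⟨y', hy'⟩ := exists_verschiebung (x := y - h) (by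
      rw [← constantCoeff_apply, map_sub]; simp [h0])
    refine ⟨g + verschiebung^[n] h, add_mem hg hh, ?_⟩
    rw [← sub_sub, hy, ← iterate_map_sub, hy', ← Function.iterate_succ_apply]
    exact truncate_iterate_verschiebung _ _

/-! ### Coordinates on the Witt vectors of a ring with a basis -/

section Coordinates

variable {ι : Type*} [Algebra R S]

/-- The map `(w i) ↦ ∑ i, [e i] * w i` from finitely supported families of Witt vectors over `R`
to Witt vectors over an `R`-algebra. -/
noncomputable def teichmullerSum (e : ι → S) : (ι →₀ WittVector p R) →+ WittVector p S :=
  Finsupp.liftAddHom fun i =>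
    (AddMonoidHom.mulLeft (teichmuller p (e i))).comp
      (WittVector.map (algebraMap R S)).toAddMonoidHom

@[simp]
theorem teichmullerSum_single (e : ι → S) (i : ι) (x : WittVector p R) :
    teichmullerSum e (Finsupp.single i x) =
      teichmuller p (e i) * WittVector.map (algebraMap R S) x := by
  simp [teichmullerSum]

theorem coeff_zero_teichmullerSum (e : ι → S) (w : ι →₀ WittVector p R) :
    (teichmullerSum e w).coeff 0 =
      Finsupp.linearCombination R e (w.mapRange constantCoeff (map_zero _)) := by
  induction w using Finsupp.induction_linear with
  | zero => simp
  | add v w hv hw =>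
    rw [map_add, ← constantCoeff_apply, map_add, constantCoeff_apply, constantCoeff_apply, hv, hw,
      Finsupp.mapRange_add (map_add _), map_add]
  | single i x =>
    rw [teichmullerSum_single, ← constantCoeff_apply, map_mul]
    simp [Algebra.smul_def, map_coeff, mul_comm]

theorem teichmullerSum_verschiebung [CharP S p] (e : ι → S) (w : ι →₀ WittVector p R) :
    teichmullerSum e (w.mapRange verschiebung (map_zero _)) =
      verschiebung (teichmullerSum (fun i => e i ^ p) w) := by
  induction w using Finsupp.induction_linear with
  | zero => simp
  | add v w hv hw => rw [Finsupp.mapRange_add (map_add _), map_add, hv, hw, map_add, map_add]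
  | single i x =>
    rw [Finsupp.mapRange_single, teichmullerSum_single, teichmullerSum_single, map_verschiebung,
      teichmuller_mul_verschiebung]

/-- If the `p ^ m`-th powers of the `e i` are linearly independent over `R` for every `m`, the
coordinates `w i` are unique in `W_n(R)`. The powers enter through `[e] * V x = V ([e ^ p] * x)`. -/
theorem truncate_eq_zero_of_teichmullerSum [CharP S p] (n : ℕ) (e : ι → S)
    (he : ∀ m, LinearIndependent R fun i => e i ^ p ^ m) (w : ι →₀ WittVector p R)
    (hw : truncate n (teichmullerSum e w) = 0) (i : ι) : truncate n (w i) = 0 := by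
  induction n generalizing e w with
  | zero => exact truncate_eq_zero_iff.2 fun _ hi => absurd hi (Nat.not_lt_zero _)
  | succ n ih =>
    have h0 : w.mapRange constantCoeff (map_zero _) = 0 := by
      have h1 : LinearIndependent R e := by simpa using he 0
      refine h1 (?_ : Finsupp.linearCombination R e _ = Finsupp.linearCombination R e 0)
      rw [← coeff_zero_teichmullerSum, map_zero]
      exact truncate_eq_zero_iff.1 hw 0 (by omega)
    obtain ⟨v, rfl⟩ : ∃ v : ι →₀ WittVector p R, w = v.mapRange verschiebung (map_zero _) := by
      refine ⟨w.mapRange (fun x => x.shift 1) ?_, ?_⟩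
      · ext i; simp [shift_coeff]
      · ext1 j
        rw [Finsupp.mapRange_apply, Finsupp.mapRange_apply]
        refine eq_iterate_verschiebung (n := 1) fun i hi => ?_
        rw [Nat.lt_one_iff.1 hi]
        exact DFunLike.congr_fun h0 j
    rw [teichmullerSum_verschiebung, truncate_verschiebung_eq_zero_iff] at hw
    rw [Finsupp.mapRange_apply, truncate_verschiebung_eq_zero_iff]
    refine ih (fun i => e i ^ p) (fun m => ?_) v hw
    simpa only [← pow_mul, ← pow_succ'] using he (m + 1)

/-- If the `p ^ m`-th powers of the `e i` span `S` over `R` for every `m`, every element of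
`W_n(S)` has coordinates in `W_n(R)`. -/
theorem exists_truncate_sub_teichmullerSum [CharP S p] (n : ℕ) (e : ι → S)
    (he : ∀ m, Submodule.span R (Set.range fun i => e i ^ p ^ m) = ⊤) (x : WittVector p S) :
    ∃ w : ι →₀ WittVector p R, truncate n (x - teichmullerSum e w) = 0 := by
  induction n generalizing e x with
  | zero => exact ⟨0, truncate_eq_zero_iff.2 fun _ hi => absurd hi (Nat.not_lt_zero _)⟩
  | succ n ih =>
    obtain ⟨c, hc⟩ : ∃ c, Finsupp.linearCombination R e c = x.coeff 0 := by
      have h1 : x.coeff 0 ∈ Submodule.span R (Set.range e) := by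
        have := he 0
        simp only [pow_zero, pow_one] at this
        rw [this]; trivial
      rwa [Finsupp.mem_span_range_iff_exists_finsupp] at h1
    let w₀ : ι →₀ WittVector p R := c.mapRange (teichmuller p) (teichmuller_zero p)
    obtain ⟨y, hy⟩ := exists_verschiebung (x := x - teichmullerSum e w₀) (by
      have h2 : w₀.mapRange constantCoeff (map_zero _) = c := by ext i; simp [w₀]
      rw [← constantCoeff_apply, map_sub, constantCoeff_apply, constantCoeff_apply,
        coeff_zero_teichmullerSum, h2, hc, sub_self])
    obtain ⟨v, hv⟩ := ih (fun i => e i ^ p) (fun m => by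
      simpa only [← pow_mul, ← pow_succ'] using he (m + 1)) y
    refine ⟨w₀ + v.mapRange verschiebung (map_zero _), ?_⟩
    rw [map_add, ← sub_sub, hy, teichmullerSum_verschiebung, ← map_sub,
      truncate_verschiebung_eq_zero_iff]
    exact hv

end Coordinates

/-- In a perfect algebra over a perfect ring, the `p ^ m`-th powers of the elements of a basis form
a basis. -/
theorem exists_basis_pow {k P ι : Type*} [CommRing k] [CharP k p] [PerfectRing k p] [CommRing P]
    [CharP P p] [PerfectRing P p] [Algebra k P] (e : Module.Basis ι k P) (m : ℕ) :
    ∃ e' : Module.Basis ι k P, ∀ i, e' i = e i ^ p ^ m := by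
  induction m with
  | zero => exact ⟨e, by simp⟩
  | succ m ih =>
    obtain ⟨e', he'⟩ := ih
    have hsum : ∀ (s : Finset ι) (c : ι → k),
        ∑ i ∈ s, c i ^ p • e' i ^ p = (∑ i ∈ s, c i • e' i) ^ p := by
      intro s c
      rw [sum_pow_char]
      simp [smul_pow]
    refine ⟨Module.Basis.mk (v := fun i => e' i ^ p) ?_ ?_, fun i => ?_⟩
    · rw [linearIndependent_iff']
      intro s g hg i hi
      have hg' : ∀ i, (_root_.frobeniusEquiv k p).symm (g i) ^ p = g i := fun i =>
        frobenius_apply_frobeniusEquiv_symm k p (g i)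
      have h1 : (∑ i ∈ s, (_root_.frobeniusEquiv k p).symm (g i) • e' i) ^ p = 0 := by
        rw [← hsum]; simpa only [hg'] using hg
      have h2 := linearIndependent_iff'.1 e'.linearIndependent s _
        ((_root_.frobeniusEquiv P p).injective (h1.trans (map_zero _).symm)) i hi
      simpa using h2
    · rintro x -
      obtain ⟨y, rfl⟩ := (_root_.frobeniusEquiv P p).surjective x
      rw [_root_.frobeniusEquiv_apply, frobenius_def, ← e'.linearCombination_repr y,
        Finsupp.linearCombination_apply, Finsupp.sum, ← hsum]
      exact Submodule.sum_mem _ fun i _ =>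
        Submodule.smul_mem _ _ (Submodule.subset_span ⟨i, rfl⟩)
    · rw [Module.Basis.mk_apply, he', ← pow_mul, pow_succ]

end Witt

/-! ### Splittings of rings -/

/-- An `F`-splitting of a ring: an additive map `σ` with `σ (a ^ p * b) = a * σ b` and
`σ 1 = 1`. -/
structure RingFSplitting (p : ℕ) (A : Type*) [CommRing A] extends A →+ A where
  map_pow_mul' (a b : A) : toFun (a ^ p * b) = a * toFun b
  map_one' : toFun 1 = 1

/-- An `n`-quasi-`F`-splitting of a ring `R` of characteristic `p`, as a map on untruncated Witt
vectors which factors through `W_n(R)`. Linearity is only required for Teichmüller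
representatives; this is enough because `p = 0` in `R`, see `RingQuasiFSplitting.frobenius_mul`. -/
structure RingQuasiFSplitting (p n : ℕ) [Fact p.Prime] (R : Type*) [CommRing R] extends
    WittVector p R →+ R where
  map_teichmuller_mul' (c : R) (x : WittVector p R) :
    toFun (teichmuller p (c ^ p) * x) = c * toFun x
  map_of_truncate' (x : WittVector p R) : truncate n x = 0 → toFun x = 0
  map_one' : toFun 1 = 1

namespace RingFSplitting

variable {p : ℕ} {A : Type*} [CommRing A] (σ : RingFSplitting p A)

theorem apply_one : σ.toAddMonoidHom 1 = 1 :=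
  σ.map_one'

theorem apply_pow (a : A) : σ.toAddMonoidHom (a ^ p) = a := by
  have := σ.map_pow_mul' a 1
  rw [mul_one, σ.map_one', mul_one] at this
  exact this

theorem iterate_map_pow_mul (m : ℕ) (a b : A) :
    σ.toAddMonoidHom^[m] (a ^ p ^ m * b) = a * σ.toAddMonoidHom^[m] b := by
  induction m generalizing b with
  | zero => simp
  | succ m ih =>
    rw [Function.iterate_succ_apply, pow_succ, pow_mul,
      show σ.toAddMonoidHom ((a ^ p ^ m) ^ p * b) = _ from σ.map_pow_mul' _ _, ih,
      Function.iterate_succ_apply]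
    rfl

variable [hp : Fact p.Prime] [CharP A p]

/-- The map `A_perf → A`, `x ^ (1 / p ^ m) ↦ σ ^ (m + 1) x`: the `p`-th root followed by the
retraction of `A → A_perf` induced by `σ`. -/
noncomputable def perfectClosureMap : PerfectClosure A p →+ A where
  toFun z := PerfectClosure.liftOn z (fun x => σ.toAddMonoidHom^[x.1 + 1] x.2) (by
    rintro _ _ ⟨m, x⟩
    simp only [frobenius_def]
    rw [Function.iterate_succ_apply _ (m + 1), σ.apply_pow])
  map_zero' := by
    rw [PerfectClosure.zero_def, PerfectClosure.liftOn_mk]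
    simp
  map_add' y z := by
    obtain ⟨⟨i, a⟩, rfl⟩ := PerfectClosure.mk_surjective A p y
    obtain ⟨⟨j, b⟩, rfl⟩ := PerfectClosure.mk_surjective A p z
    have key : ∀ (i j : ℕ) (a : A),
        σ.toAddMonoidHom^[i + j + 1] ((frobenius A p)^[j] a) = σ.toAddMonoidHom^[i + 1] a := by
      intro i j a
      rw [iterate_frobenius, show i + j + 1 = (i + 1) + j by ring, Function.iterate_add_apply]
      have := σ.iterate_map_pow_mul j a 1
      rw [mul_one] at this
      rw [this, Function.iterate_fixed (show σ.toAddMonoidHom 1 = 1 from σ.map_one'), mul_one]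
    simp only [PerfectClosure.mk_add_mk, PerfectClosure.liftOn_mk]
    rw [iterate_map_add, key, add_comm i j, key]

theorem perfectClosureMap_mk (m : ℕ) (a : A) :
    σ.perfectClosureMap (PerfectClosure.mk A p (m, a)) = σ.toAddMonoidHom^[m + 1] a :=
  rfl

/-- Linearity over `A` along the Frobenius. -/
theorem perfectClosureMap_of_pow_mul (a : A) (z : PerfectClosure A p) :
    σ.perfectClosureMap (PerfectClosure.of A p a ^ p * z) = a * σ.perfectClosureMap z := by
  obtain ⟨⟨m, b⟩, rfl⟩ := PerfectClosure.mk_surjective A p z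
  rw [PerfectClosure.of_apply, PerfectClosure.mk_pow, PerfectClosure.mk_mul_mk,
    perfectClosureMap_mk, perfectClosureMap_mk]
  simp only [zero_add, iterate_frobenius]
  rw [pow_zero, pow_one, ← pow_mul, ← pow_succ', iterate_map_pow_mul]

end RingFSplitting

variable {p n : ℕ} [hp : Fact p.Prime]

namespace RingQuasiFSplitting

section

variable {R : Type*} [CommRing R] (τ : RingQuasiFSplitting p n R)

noncomputable instance : CoeFun (RingQuasiFSplitting p n R) fun _ => WittVector p R → R :=
  ⟨fun τ => τ.toAddMonoidHom⟩

theorem apply_teichmuller_mul (c : R) (x : WittVector p R) :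
    τ (teichmuller p (c ^ p) * x) = c * τ x :=
  τ.map_teichmuller_mul' c x

theorem apply_of_truncate {x : WittVector p R} (hx : truncate n x = 0) : τ x = 0 :=
  τ.map_of_truncate' x hx

theorem apply_one : τ 1 = 1 :=
  τ.map_one'

theorem frobenius_mul [CharP R p] (z x : WittVector p R) :
    τ (frobenius z * x) = z.coeff 0 * τ x := by
  obtain ⟨t, ht⟩ := exists_frobenius_mul_eq z x
  rw [ht, map_add, τ.apply_teichmuller_mul, ← nsmul_eq_mul, map_nsmul, nsmul_eq_mul,
    CharP.cast_eq_zero, zero_mul, add_zero]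

theorem apply_iterate_verschiebung_mul (hR : (p : R) = 0) (m : ℕ) (r b : R) :
    τ (verschiebung^[m] (teichmuller p (r ^ p ^ (m + 1) * b))) =
      r * τ (verschiebung^[m] (teichmuller p b)) := by
  rcases subsingleton_or_nontrivial R with h | h
  · exact Subsingleton.elim _ _
  · have : CharP R p := (CharP.charP_iff_prime_eq_zero hp.out).2 hR
    rw [map_mul, pow_succ', pow_mul, ← teichmuller_mul_iterate_verschiebung,
      τ.apply_teichmuller_mul]

end

/-! ### Tensor products over a perfect field -/

section Tensor

variable {k A B : Type*} [Field k] [CharP k p] [PerfectField k] [CommRing A] [CommRing B]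
  [Algebra k A] [Algebra k B]

/-- If `P` is a perfect `k`-algebra, every Witt vector over `B ⊗ P` is modulo `V ^ n` a sum
`∑ [e i] * w i` with unique `w i ∈ W_n(B)`, where `e` is a basis of `P`. So maps out of
`W_n(B ⊗ P)` can be prescribed on `[z] * w` for `z ∈ P` and `w ∈ W_n(B)`. -/
theorem exists_extend_perfect {P : Type*} [CommRing P] [CharP P p] [PerfectRing P p] [Algebra k P]
    [Nontrivial B] (ρ : P →+ A) (hρ : ∀ (c : k) z, ρ (algebraMap k P c ^ p * z) = c • ρ z)
    (τ : RingQuasiFSplitting p n B) :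
    ∃ Ψ : WittVector p (B ⊗[k] P) →+ A ⊗[k] B, (∀ x, truncate n x = 0 → Ψ x = 0) ∧
      ∀ (z : P) (w : WittVector p B),
        Ψ (teichmuller p (1 ⊗ₜ z) * WittVector.map (algebraMap B (B ⊗[k] P)) w) =
          ρ z ⊗ₜ τ w := by
  have : PerfectRing k p := PerfectField.toPerfectRing p
  have : Nontrivial P := CharP.nontrivial_of_char_ne_one (R := P) hp.out.ne_one
  have : CharP (B ⊗[k] P) p :=
    charP_of_injective_algebraMap (algebraMap k (B ⊗[k] P)).injective p
  have hzero : ∀ x : A ⊗[k] B, p • x = 0 := fun x => by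
    rw [nsmul_eq_mul, ← map_natCast (algebraMap k (A ⊗[k] B)), CharP.cast_eq_zero, map_zero,
      zero_mul]
  let b := Module.Basis.ofVectorSpace k P
  let e : Module.Basis.ofVectorSpaceIndex k P → B ⊗[k] P := fun i => 1 ⊗ₜ b i
  have he : ∀ m, ∃ e' : Module.Basis _ B (B ⊗[k] P), ⇑e' = fun i => e i ^ p ^ m := by
    intro m
    obtain ⟨b', hb'⟩ := exists_basis_pow (p := p) b m
    refine ⟨Algebra.TensorProduct.basis B b', ?_⟩
    ext1 i
    rw [Algebra.TensorProduct.basis_apply, hb', Algebra.TensorProduct.tmul_pow, one_pow]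
  have hind : ∀ m, LinearIndependent B fun i => e i ^ p ^ m := fun m => by
    obtain ⟨e', h⟩ := he m
    exact h ▸ e'.linearIndependent
  have hspan : ∀ m, Submodule.span B (Set.range fun i => e i ^ p ^ m) = ⊤ := fun m => by
    obtain ⟨e', h⟩ := he m
    exact h ▸ e'.span_eq
  let E := (truncate (p := p) (R := B ⊗[k] P) n).toAddMonoidHom.comp
    (teichmullerSum (p := p) (R := B) e)
  have hE : Function.Surjective E := fun x => by
    obtain ⟨x, rfl⟩ := truncate_surjective (p := p) n _ x
    obtain ⟨w, hw⟩ := exists_truncate_sub_teichmullerSum n e hspan x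
    rw [map_sub, sub_eq_zero] at hw
    exact ⟨w, hw.symm⟩
  let G : (Module.Basis.ofVectorSpaceIndex k P →₀ WittVector p B) →+ A ⊗[k] B :=
    Finsupp.liftAddHom fun i =>
      (TensorProduct.mk k A B (ρ (b i))).toAddMonoidHom.comp τ.toAddMonoidHom
  have hG : ∀ i w, G (Finsupp.single i w) = ρ (b i) ⊗ₜ τ w := fun i w => by
    simp [G]
  have hEG : E.ker ≤ G.ker := by
    intro w hw
    have := truncate_eq_zero_of_teichmullerSum n e hind w hw
    change Finsupp.sum w (fun i x => ρ (b i) ⊗ₜ[k] τ x) = 0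
    refine Finset.sum_eq_zero fun i _ => ?_
    change ρ (b i) ⊗ₜ[k] τ (w i) = 0
    rw [τ.apply_of_truncate (this i), tmul_zero]
  let Ψ := (E.liftOfRightInverse _ (Function.rightInverse_surjInv hE) ⟨G, hEG⟩).comp
    (truncate (p := p) (R := B ⊗[k] P) n).toAddMonoidHom
  have hΨ : ∀ w, Ψ (teichmullerSum e w) = G w :=
    E.liftOfRightInverse_comp_apply _ (Function.rightInverse_surjInv hE) ⟨G, hEG⟩
  refine ⟨Ψ, fun x hx => ?_, fun z w => ?_⟩
  · change E.liftOfRightInverse _ (Function.rightInverse_surjInv hE) ⟨G, hEG⟩ (truncate n x) = 0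
    rw [hx, map_zero]
  -- The formula holds for the basis vectors by construction; it is additive in `z` because `[z]`
  -- is additive modulo `p` over a perfect ring.
  obtain ⟨c, rfl⟩ := b.repr.symm.surjective z
  induction c using Finsupp.induction_linear with
  | zero => simp
  | add c d hc hd =>
    rw [map_add, map_add, add_tmul, ← hc, ← hd]
    generalize b.repr.symm c = y
    generalize b.repr.symm d = y'
    obtain ⟨v, hv⟩ := exists_verschiebung
      (x := teichmuller p (y + y') - teichmuller p y - teichmuller p y') (by
        rw [← constantCoeff_apply, map_sub, map_sub]; simp)
    obtain ⟨t, rfl⟩ := (WittVector.frobenius_bijective p P).surjective v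
    rw [verschiebung_frobenius, sub_sub, sub_eq_iff_eq_add] at hv
    let j : P →+* B ⊗[k] P := (Algebra.TensorProduct.includeRight : P →ₐ[k] _).toRingHom
    have hj : ∀ a : P, teichmuller p ((1 : B) ⊗ₜ[k] a) = WittVector.map j (teichmuller p a) :=
      fun a => by rw [map_teichmuller]; rfl
    rw [hj, hj, hj, hv, map_add (WittVector.map j), map_mul (WittVector.map j),
      map_add (WittVector.map j), map_natCast, add_mul,
      mul_comm (WittVector.map j t), mul_assoc, ← nsmul_eq_mul, map_add, map_nsmul, hzero,
      zero_add, add_mul, map_add]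
  | single i c =>
    obtain ⟨d, rfl⟩ := (_root_.frobeniusEquiv k p).surjective c
    have h1 : b.repr.symm (Finsupp.single i (_root_.frobeniusEquiv k p d)) =
        algebraMap k P d ^ p * b i := by
      rw [b.repr_symm_single, Algebra.smul_def, _root_.frobeniusEquiv_apply, frobenius_def, map_pow]
    have h2 : (1 : B) ⊗ₜ[k] (algebraMap k P d ^ p * b i) =
        e i * algebraMap B (B ⊗[k] P) (algebraMap k B d ^ p) := by
      rw [← map_pow, ← map_pow, ← Algebra.smul_def, tmul_smul, smul_tmul',
        Algebra.TensorProduct.algebraMap_apply, Algebra.TensorProduct.tmul_mul_tmul]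
      simp [Algebra.smul_def]
    rw [h1, h2, map_mul (teichmuller p), mul_assoc, ← map_teichmuller, ← map_mul,
      ← teichmullerSum_single, hΨ, hG, τ.apply_teichmuller_mul, hρ, smul_tmul, Algebra.smul_def]

/-- The tensor product over a perfect field of an `F`-splitting `σ` and an `n`-quasi-`F`-splitting
`τ`. In `W_n(A_perf ⊗ B)` one has `V ^ m [a ⊗ b] = [a ^ (1 / p ^ m)] * V ^ m [b]`, whose image
under `exists_extend_perfect` is the stated one. -/
theorem exists_tensor [CharP A p] [Nontrivial B] (σ : RingFSplitting p A)
    (τ : RingQuasiFSplitting p n B) :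
    ∃ Φ : RingQuasiFSplitting p n (A ⊗[k] B), ∀ (m : ℕ) (a : A) (b : B),
      Φ (verschiebung^[m] (teichmuller p (a ⊗ₜ b))) =
        (σ.toAddMonoidHom^[m + 1] a) ⊗ₜ τ (verschiebung^[m] (teichmuller p b)) := by
  let P := PerfectClosure A p
  let i : A →+* P := PerfectClosure.of A p
  let : Algebra k P := (i.comp (algebraMap k A)).toAlgebra
  let iA : A →ₐ[k] P := ⟨i, fun _ => rfl⟩
  have : CharP B p := charP_of_injective_algebraMap (algebraMap k B).injective p
  have : Nontrivial P := CharP.nontrivial_of_char_ne_one (R := P) hp.out.ne_one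
  have : Nontrivial A := CharP.nontrivial_of_char_ne_one (R := A) hp.out.ne_one
  have : CharP (B ⊗[k] P) p :=
    charP_of_injective_algebraMap (algebraMap k (B ⊗[k] P)).injective p
  have : CharP (A ⊗[k] B) p :=
    charP_of_injective_algebraMap (algebraMap k (A ⊗[k] B)).injective p
  obtain ⟨Ψ, hΨ, hΨ'⟩ := exists_extend_perfect (k := k) (P := P) σ.perfectClosureMap (fun c z => by
    rw [Algebra.smul_def]; exact σ.perfectClosureMap_of_pow_mul _ z) τ
  let j : A ⊗[k] B →+* B ⊗[k] P := (Algebra.TensorProduct.lift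
    (Algebra.TensorProduct.includeRight.comp iA) Algebra.TensorProduct.includeLeft
    fun _ _ => Commute.all _ _).toRingHom
  have hj : ∀ a b, j (a ⊗ₜ b) = (1 ⊗ₜ i a) * algebraMap B (B ⊗[k] P) b := fun a b =>
    Algebra.TensorProduct.lift_tmul ..
  have hgen : ∀ m, AddSubgroup.closure
      {x | ∃ (z : P) (b : B), x = (1 ⊗ₜ z) ^ p ^ m * algebraMap B (B ⊗[k] P) b} = ⊤ := by
    refine fun m => eq_top_iff.2 fun x _ => ?_
    induction x using TensorProduct.induction_on with
    | zero => exact zero_mem _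
    | add x y hx hy => exact add_mem (hx trivial) (hy trivial)
    | tmul b z =>
      obtain ⟨z, rfl⟩ := (iterateFrobeniusEquiv P p m).surjective z
      refine AddSubgroup.subset_closure ⟨z, b, ?_⟩
      rw [Algebra.TensorProduct.tmul_pow, Algebra.TensorProduct.algebraMap_apply,
        Algebra.TensorProduct.tmul_mul_tmul]
      simp [iterateFrobeniusEquiv_apply, iterateFrobenius_def]
  have hlin : ∀ (c : A ⊗[k] B) (y : WittVector p (B ⊗[k] P)),
      Ψ (teichmuller p (j c ^ p) * y) = c * Ψ y := by
    -- The Frobenius kills the failure of `[·]` to be additive modulo `p`, so that `c` may be taken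
    -- to be a pure tensor; and `W_n(B ⊗ P)` is generated by the `V ^ m [z ^ (p ^ m) ⊗ b]`.
    intro c y
    induction c using TensorProduct.induction_on with
    | zero => simp [hp.out.ne_zero]
    | add c d hc hd =>
      obtain ⟨t, ht⟩ := exists_frobenius_mul_eq (teichmuller p (j c) + teichmuller p (j d)) y
      rw [← constantCoeff_apply, map_add constantCoeff, constantCoeff_apply, constantCoeff_apply,
        teichmuller_coeff_zero, teichmuller_coeff_zero, ← map_add j, map_add WittVector.frobenius,
        frobenius_teichmuller, frobenius_teichmuller, add_mul, ← sub_eq_iff_eq_add] at ht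
      rw [← ht, ← nsmul_eq_mul, map_sub, map_add, map_nsmul, nsmul_eq_mul, CharP.cast_eq_zero,
        zero_mul, sub_zero, hc, hd, add_mul]
    | tmul a b =>
      obtain ⟨g, hg, hyg⟩ := exists_mem_closure_iterate_verschiebung
        (fun m => {x | ∃ (z : P) (b : B), x = (1 ⊗ₜ z) ^ p ^ m * algebraMap B (B ⊗[k] P) b})
        hgen n y
      have hyg' : truncate n (teichmuller p (j (a ⊗ₜ b) ^ p) * (y - g)) = 0 := by
        rw [map_mul, hyg, mul_zero]
      have h1 := hΨ _ hyg
      have h2 := hΨ _ hyg'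
      rw [map_sub, sub_eq_zero] at h1
      rw [mul_sub, map_sub, sub_eq_zero] at h2
      rw [h1, h2]
      clear h1 h2 hyg hyg'
      induction hg using AddSubgroup.closure_induction with
      | mem x hx =>
        obtain ⟨m, _, ⟨z, b', rfl⟩, rfl⟩ := hx
        have h3 : teichmuller p (j (a ⊗ₜ b) ^ p) =
            teichmuller p (1 ⊗ₜ (i a ^ p)) *
              WittVector.map (algebraMap B (B ⊗[k] P)) (teichmuller p (b ^ p)) := by
          rw [hj, mul_pow, Algebra.TensorProduct.tmul_pow, one_pow, map_mul, map_teichmuller,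
            map_pow (algebraMap B _)]
        rw [map_mul (teichmuller p), ← teichmuller_mul_iterate_verschiebung, ← map_teichmuller,
          ← map_iterate_verschiebung, h3, mul_mul_mul_comm, ← map_mul, ← map_mul,
          Algebra.TensorProduct.tmul_mul_tmul, one_mul, hΨ', hΨ', τ.apply_teichmuller_mul,
          σ.perfectClosureMap_of_pow_mul, Algebra.TensorProduct.tmul_mul_tmul]
      | zero => simp
      | add x y _ _ hx hy => rw [mul_add, map_add, hx, hy, map_add, mul_add]
      | neg x _ hx => rw [mul_neg, map_neg, hx, map_neg, mul_neg]
  -- In `W(B ⊗ P)` this is `V ^ m [a ⊗ b] = [a ^ (1 / p ^ m)] * V ^ m [b]`.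
  have hval : ∀ (m : ℕ) (a : A) (b : B),
      Ψ (WittVector.map j (verschiebung^[m] (teichmuller p (a ⊗ₜ b)))) =
        (σ.toAddMonoidHom^[m + 1] a) ⊗ₜ τ (verschiebung^[m] (teichmuller p b)) := by
    intro m a b
    have hz : PerfectClosure.mk A p (m, a) ^ p ^ m = i a := by
      rw [← iterate_frobenius, PerfectClosure.iterate_frobenius_mk]
    rw [map_iterate_verschiebung, map_teichmuller, hj, ← hz, ← one_pow (p ^ m),
      ← Algebra.TensorProduct.tmul_pow, map_mul (teichmuller p),
      ← teichmuller_mul_iterate_verschiebung, ← map_teichmuller, ← map_iterate_verschiebung, hΨ']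
    rfl
  refine ⟨⟨Ψ.comp (WittVector.map j).toAddMonoidHom, fun c x => ?_, fun x hx => ?_, ?_⟩, hval⟩
  · change Ψ (WittVector.map j (teichmuller p (c ^ p) * x)) = c * Ψ (WittVector.map j x)
    rw [map_mul, map_teichmuller, map_pow, hlin]
  · exact hΨ _ (truncate_map_eq_zero j hx)
  · have := hval 0 1 1
    simp only [Function.iterate_zero, id, map_one, zero_add, Function.iterate_one, τ.apply_one,
      ← Algebra.TensorProduct.one_def] at this
    rw [σ.apply_one] at this
    change Ψ (WittVector.map j 1) = 1
    rw [map_one]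
    exact this

end Tensor

end RingQuasiFSplitting

/-! ### Localization -/

theorem coeff_teichmuller_mul {p : ℕ} [hp : Fact p.Prime] {R : Type*} [CommRing R] [CharP R p]
    (a : R) (x : WittVector p R) (i : ℕ) :
    (teichmuller p a * x).coeff i = a ^ p ^ i * x.coeff i := by
  -- `x = [x₀] + V x'`, and such sums have disjoint components.
  have disj : ∀ (c : R) (y : WittVector p R) (i : ℕ), (teichmuller p c + verschiebung y).coeff i =
      (teichmuller p c).coeff i + (verschiebung y).coeff i := by
    intro c y i
    refine coeff_add_of_disjoint i _ _ fun j => ?_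
    cases j with
    | zero => exact Or.inr (verschiebung_coeff_zero y)
    | succ j => exact Or.inl (teichmuller_coeff_pos p c _ j.succ_pos)
  induction i generalizing a x with
  | zero => rw [← constantCoeff_apply, map_mul]; simp
  | succ i ih =>
    have hx : x = teichmuller p (x.coeff 0) + verschiebung (x.shift 1) := by
      ext j
      rw [disj]
      cases j with
      | zero => simp
      | succ j =>
        rw [teichmuller_coeff_pos p _ _ j.succ_pos, verschiebung_coeff_succ, zero_add, shift_coeff,
          add_comm]
    conv_lhs => rw [hx]
    rw [mul_add, ← map_mul, teichmuller_mul_verschiebung, disj,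
      teichmuller_coeff_pos p _ _ i.succ_pos, verschiebung_coeff_succ, zero_add, ih, ← pow_mul,
      ← pow_succ', shift_coeff, add_comm]

namespace RingQuasiFSplitting

variable {p n : ℕ} [hp : Fact p.Prime]

section Localization

variable {C R : Type*} [CommRing C] [CommRing R] [Algebra C R] (M : Submonoid C)
  [IsLocalization M R] [CharP C p] [CharP R p]

include M in
omit [CharP R p] in
/-- If `y` vanishes in `W_n(R)`, a denominator kills its value `Φ y`. -/
theorem exists_mul_eq_zero (Φ : RingQuasiFSplitting p n C) (y : WittVector p C)
    (hy : truncate n (WittVector.map (algebraMap C R) y) = 0) : ∃ u ∈ M, u * Φ y = 0 := by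
  rw [truncate_eq_zero_iff] at hy
  have h1 : ∀ i, ∃ u : M, i < n → u * y.coeff i = 0 := by
    intro i
    by_cases hi : i < n
    · have := hy i hi
      rw [map_coeff, IsLocalization.map_eq_zero_iff M] at this
      obtain ⟨u, hu⟩ := this
      exact ⟨u, fun _ => hu⟩
    · exact ⟨1, fun h => absurd h hi⟩
  choose u hu using h1
  let v : M := ∏ i ∈ Finset.range n, u i
  refine ⟨v, v.2, ?_⟩
  rw [← Φ.apply_teichmuller_mul]
  refine Φ.apply_of_truncate (truncate_eq_zero_iff.2 fun i hi => ?_)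
  rw [coeff_teichmuller_mul, ← pow_mul]
  obtain ⟨w, hw⟩ : (u i : C) ∣ v ^ (p * p ^ i) :=
    dvd_pow ((map_dvd M.subtype (Finset.dvd_prod_of_mem u (Finset.mem_range.2 hi))))
      (mul_ne_zero hp.out.ne_zero (pow_ne_zero _ hp.out.ne_zero))
  rw [hw, mul_right_comm, hu i hi, zero_mul]

omit [CharP C p] in
/-- Common denominators in `W_n(R)`, for a localization `R` of `C`. -/
theorem exists_truncate_map_eq (x : WittVector p R) :
    ∃ t ∈ M, ∃ y : WittVector p C, truncate n (teichmuller p (algebraMap C R t ^ p) * x) =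
      truncate n (WittVector.map (algebraMap C R) y) := by
  obtain ⟨t, ht⟩ := IsLocalization.exist_integer_multiples M (Finset.range n) x.coeff
  have h1 : ∀ i, ∃ c : C, i < n →
      algebraMap C R c = (algebraMap C R t ^ p) ^ p ^ i * x.coeff i := by
    intro i
    by_cases hi : i < n
    · obtain ⟨c, hc⟩ := ht i (Finset.mem_range.2 hi)
      refine ⟨(t : C) ^ (p * p ^ i - 1) * c, fun _ => ?_⟩
      rw [map_mul, hc, Algebra.smul_def, ← mul_assoc, map_pow, ← pow_succ, ← pow_mul,
        Nat.sub_add_cancel (Nat.mul_pos hp.out.pos (pow_pos hp.out.pos _))]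
    · exact ⟨0, fun h => absurd h hi⟩
  choose c hc using h1
  refine ⟨t, t.2, WittVector.mk p c, ?_⟩
  rw [TruncatedWittVector.ext_iff]
  intro i
  rw [coeff_truncate, coeff_truncate, coeff_teichmuller_mul, map_coeff, coeff_mk, hc i i.2]

include M in
/-- A quasi-`F`-splitting extends to localizations. -/
theorem exists_localization (Φ : RingQuasiFSplitting p n C) :
    ∃ Φ' : RingQuasiFSplitting p n R,
      ∀ y, Φ' (WittVector.map (algebraMap C R) y) = algebraMap C R (Φ y) := by
  -- The value at `x` is `Φ y / t` whenever `F [t] * x = y` in `W_n(R)`.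
  have key : ∀ x : WittVector p R, ∃ s : R, ∀ t ∈ M, ∀ y : WittVector p C,
      truncate n (teichmuller p (algebraMap C R t ^ p) * x) =
        truncate n (WittVector.map (algebraMap C R) y) →
      algebraMap C R t * s = algebraMap C R (Φ y) := by
    intro x
    obtain ⟨t₀, ht₀, y₀, h₀⟩ := exists_truncate_map_eq (p := p) (n := n) M x
    refine ⟨IsLocalization.mk' R (Φ y₀) (⟨t₀, ht₀⟩ : M), fun t ht y h => ?_⟩
    have h1 : truncate n (WittVector.map (algebraMap C R)
        (teichmuller p (t ^ p) * y₀ - teichmuller p (t₀ ^ p) * y)) = 0 := by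
      simp only [map_sub, map_mul, map_pow, map_teichmuller] at h h₀ ⊢
      rw [← h₀, ← h]
      ring
    obtain ⟨u, hu, hu0⟩ := exists_mul_eq_zero M Φ _ h1
    rw [map_sub, Φ.apply_teichmuller_mul, Φ.apply_teichmuller_mul] at hu0
    rw [IsLocalization.mul_mk'_eq_mk'_of_mul, IsLocalization.mk'_eq_iff_eq_mul, ← map_mul]
    refine (IsLocalization.eq_iff_exists M R).2 ⟨⟨u, hu⟩, ?_⟩
    rw [← sub_eq_zero, ← mul_sub, ← hu0]
    ring
  choose f hf using key
  have uniq : ∀ x s, ∀ t ∈ M, ∀ y : WittVector p C,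
      truncate n (teichmuller p (algebraMap C R t ^ p) * x) =
        truncate n (WittVector.map (algebraMap C R) y) →
      algebraMap C R t * s = algebraMap C R (Φ y) → f x = s := by
    intro x s t ht y h hs
    exact (IsLocalization.map_units R (⟨t, ht⟩ : M)).mul_left_cancel ((hf x t ht y h).trans hs.symm)
  have hmap : ∀ y, f (WittVector.map (algebraMap C R) y) = algebraMap C R (Φ y) := fun y =>
    uniq _ _ 1 M.one_mem y (by simp) (by simp)
  refine ⟨⟨⟨⟨f, ?_⟩, fun x x' => ?_⟩, fun c x => ?_, fun x hx => ?_, ?_⟩, hmap⟩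
  · have := hmap 0
    rwa [map_zero, map_zero, map_zero] at this
  · obtain ⟨t, ht, y, h⟩ := exists_truncate_map_eq (p := p) (n := n) M x
    obtain ⟨t', ht', y', h'⟩ := exists_truncate_map_eq (p := p) (n := n) M x'
    refine uniq _ _ (t * t') (M.mul_mem ht ht')
      (teichmuller p (t' ^ p) * y + teichmuller p (t ^ p) * y') ?_ ?_
    · simp only [map_add, map_mul, map_pow, map_teichmuller] at h h' ⊢
      rw [← h, ← h']
      ring
    · rw [map_add, Φ.apply_teichmuller_mul, Φ.apply_teichmuller_mul, map_add, map_mul, map_mul,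
        map_mul, ← hf x t ht y h, ← hf x' t' ht' y' h']
      change _ * (f x + f x') = _
      ring
  · change f (teichmuller p (c ^ p) * x) = c * f x
    obtain ⟨⟨d, s⟩, hd⟩ := IsLocalization.surj M c
    obtain ⟨t, ht, y, h⟩ := exists_truncate_map_eq (p := p) (n := n) M x
    refine uniq _ _ (s * t) (M.mul_mem s.2 ht) (teichmuller p (d ^ p) * y) ?_ ?_
    · simp only [map_mul, map_pow, map_teichmuller] at h ⊢
      rw [← h, ← hd]
      simp only [map_mul]
      ring
    · rw [Φ.apply_teichmuller_mul, map_mul, map_mul, ← hf x t ht y h, ← hd]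
      ring
  · exact uniq x 0 1 M.one_mem 0 (by rw [map_mul, hx]; simp) (by simp)
  · have := hmap 1
    rwa [map_one, Φ.apply_one, map_one] at this

end Localization

end RingQuasiFSplitting

/-! ### Cocartesian squares of rings -/

section Pushout

variable {p n : ℕ} [hp : Fact p.Prime] {k : Type u} [Field k] {A B C : CommRingCat.{u}}
  {i : CommRingCat.of k ⟶ A} {j : CommRingCat.of k ⟶ B} {α : A ⟶ C} {β : B ⟶ C}

/-- The tensor product of the two rings under `k` is the pushout. -/
theorem exists_tensorProduct_equiv (h : IsPushout i j α β) :
    letI := i.hom.toAlgebra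
    letI := j.hom.toAlgebra
    ∃ e : A ⊗[k] B ≃+* C, ∀ a b, e (a ⊗ₜ b) = α.hom a * β.hom b := by
  let := i.hom.toAlgebra
  let := j.hom.toAlgebra
  have h' : IsPushout i j _ _ := CommRingCat.isPushout_tensorProduct k A B
  refine ⟨(h'.isoIsPushout _ _ h).commRingCatIsoToRingEquiv, fun a b => ?_⟩
  have h1 := congr($(h'.inl_isoIsPushout_hom _ _ h).hom a)
  have h2 := congr($(h'.inr_isoIsPushout_hom _ _ h).hom b)
  rw [← mul_one a, ← one_mul b, ← Algebra.TensorProduct.tmul_mul_tmul, map_mul, mul_one, one_mul]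
  exact congr_arg₂ (· * ·) h1 h2

theorem closure_mul_eq_top_of_isPushout (h : IsPushout i j α β) :
    AddSubgroup.closure {c : C | ∃ a b, c = α.hom a * β.hom b} = ⊤ := by
  let := i.hom.toAlgebra
  let := j.hom.toAlgebra
  obtain ⟨e, he⟩ := exists_tensorProduct_equiv h
  refine eq_top_iff.2 fun c _ => ?_
  obtain ⟨x, rfl⟩ := e.surjective c
  induction x using TensorProduct.induction_on with
  | zero => rw [map_zero]; exact zero_mem _
  | add x y hx hy => rw [map_add]; exact add_mem (hx trivial) (hy trivial)
  | tmul a b => exact AddSubgroup.subset_closure ⟨a, b, he a b⟩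

/-- The product splitting of `RingQuasiFSplitting.exists_tensor` on any pushout of rings. -/
theorem RingQuasiFSplitting.exists_of_isPushout [CharP k p] [PerfectField k]
    (h : IsPushout i j α β) [CharP A p] [Nontrivial B] (σ : RingFSplitting p A)
    (τ : RingQuasiFSplitting p n B) :
    ∃ Φ : RingQuasiFSplitting p n C, ∀ (m : ℕ) (a : A) (b : B),
      Φ (verschiebung^[m] (teichmuller p (α.hom a * β.hom b))) =
        α.hom (σ.toAddMonoidHom^[m + 1] a) *
          β.hom (τ (verschiebung^[m] (teichmuller p b))) := by
  let := i.hom.toAlgebra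
  let := j.hom.toAlgebra
  obtain ⟨e, he⟩ := exists_tensorProduct_equiv h
  obtain ⟨Φ, hΦ⟩ := RingQuasiFSplitting.exists_tensor (k := k) σ τ
  have hval : ∀ (m : ℕ) (a : A) (b : B),
      e (Φ (WittVector.map (e.symm : C →+* A ⊗[k] B)
        (verschiebung^[m] (teichmuller p (α.hom a * β.hom b))))) =
        α.hom (σ.toAddMonoidHom^[m + 1] a) *
          β.hom (τ (verschiebung^[m] (teichmuller p b))) := by
    intro m a b
    rw [map_iterate_verschiebung, map_teichmuller, ← he, RingHom.coe_coe, e.symm_apply_apply, hΦ,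
      he]
  refine ⟨⟨(e.toRingHom.toAddMonoidHom.comp Φ.toAddMonoidHom).comp
    (WittVector.map (e.symm : C →+* A ⊗[k] B)).toAddMonoidHom, fun c x => ?_, fun x hx => ?_, ?_⟩,
    hval⟩
  · change e (Φ (WittVector.map _ _)) = c * e (Φ (WittVector.map _ _))
    rw [map_mul, map_teichmuller, map_pow, Φ.apply_teichmuller_mul, map_mul, RingHom.coe_coe,
      e.apply_symm_apply]
  · change e (Φ (WittVector.map _ _)) = 0
    rw [Φ.apply_of_truncate (truncate_map_eq_zero _ hx), map_zero]
  · change e (Φ (WittVector.map _ _)) = 1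
    rw [map_one, Φ.apply_one, map_one]

end Pushout

/-! ### Sections and germs on a scheme -/

section Sections

variable {p n : ℕ} {X : Scheme.{u}}

theorem IsFpScheme.cast_eq_zero (hX : IsFpScheme p X) (U : X.Opens) : (p : Γ(X, U)) = 0 := by
  have h : (X.presheaf.map (homOfLE le_top : U ⟶ ⊤).op).hom (p : Γ(X, ⊤)) = 0 := by
    rw [hX, map_zero]
  rwa [map_natCast] at h

theorem IsFpScheme.cast_stalk_eq_zero (hX : IsFpScheme p X) (x : X) :
    (p : X.presheaf.stalk x) = 0 := by
  have h : (X.presheaf.germ ⊤ x trivial).hom (p : Γ(X, ⊤)) = 0 := by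
    rw [hX, map_zero]
  rwa [map_natCast] at h

theorem IsFpScheme.of_hom (hX : IsFpScheme p X) {Y : Scheme.{u}} (f : Y ⟶ X) :
    IsFpScheme p Y := by
  have h : f.appTop.hom (p : Γ(X, ⊤)) = 0 := by
    rw [hX, map_zero]
  rwa [map_natCast] at h

theorem IsFpScheme.charP_stalk [hp : Fact p.Prime] (hX : IsFpScheme p X) (x : X) :
    CharP (X.presheaf.stalk x) p :=
  (CharP.charP_iff_prime_eq_zero hp.out).2 (hX.cast_stalk_eq_zero x)

theorem nontrivial_of_mem {U : X.Opens} {x : X} (hx : x ∈ U) : Nontrivial Γ(X, U) :=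
  (X.presheaf.germ U x hx).hom.domain_nontrivial

theorem IsFpScheme.charP [hp : Fact p.Prime] (hX : IsFpScheme p X) {U : X.Opens} {x : X}
    (hx : x ∈ U) : CharP Γ(X, U) p :=
  have := nontrivial_of_mem hx
  (CharP.charP_iff_prime_eq_zero hp.out).2 (hX.cast_eq_zero U)

/-- An `F`-splitting of a scheme on the sections over an open set. -/
def FSplitting.ring (s : FSplitting p X) (U : X.Opens) : RingFSplitting p Γ(X, U) where
  toAddMonoidHom := s.app U
  map_pow_mul' := s.map_smul U
  map_one' := by
    have := s.comp_frobenius U 1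
    rwa [one_pow] at this

theorem FSplitting.iterate_naturality (s : FSplitting p X) (m : ℕ) {U V : X.Opens} (i : U ⟶ V)
    (a : Γ(X, V)) :
    (s.ring U).toAddMonoidHom^[m] ((X.presheaf.map i.op).hom a) =
      (X.presheaf.map i.op).hom ((s.ring V).toAddMonoidHom^[m] a) := by
  induction m with
  | zero => rfl
  | succ m ih =>
    rw [Function.iterate_succ_apply', ih, Function.iterate_succ_apply']
    exact s.naturality i _

theorem wittFrobenius_truncate_teichmuller [hp : Fact p.Prime] {R : Type*} [CommRing R] (c : R) :
    wittFrobenius p n (truncate n (teichmuller p c)) = truncate n (teichmuller p (c ^ p)) := by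
  ext ⟨i, hi⟩
  rw [wittFrobenius, TruncatedWittVector.coeff_mk, coeff_truncate, coeff_truncate]
  cases i with
  | zero => simp only [teichmuller_coeff_zero]
  | succ i =>
    rw [teichmuller_coeff_pos p _ _ i.succ_pos, teichmuller_coeff_pos p _ _ i.succ_pos,
      zero_pow hp.out.ne_zero]

/-- An `n`-quasi-`F`-splitting of a scheme on the sections over an open set. -/
noncomputable def QuasiFSplitting.ring [hp : Fact p.Prime] [NeZero n] (t : QuasiFSplitting p n X)
    (U : X.Opens) : RingQuasiFSplitting p n Γ(X, U) where
  toAddMonoidHom := (t.app U).comp (truncate n).toAddMonoidHom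
  map_teichmuller_mul' c x := by
    change t.app U (truncate n (teichmuller p (c ^ p) * x)) = c * t.app U (truncate n x)
    rw [map_mul, ← wittFrobenius_truncate_teichmuller, t.map_smul, coeff_truncate]
    simp
  map_of_truncate' x hx := by
    change t.app U (truncate n x) = 0
    rw [hx, map_zero]
  map_one' := by
    have := t.comp_frobenius U (truncate n (teichmuller p 1))
    rw [wittFrobenius_truncate_teichmuller, coeff_truncate] at this
    change t.app U (truncate n 1) = 1
    simpa using this

theorem QuasiFSplitting.ring_naturality [hp : Fact p.Prime] [NeZero n]
    (t : QuasiFSplitting p n X) {U V : X.Opens} (i : U ⟶ V) (x : WittVector p Γ(X, V)) :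
    t.ring U (WittVector.map (X.presheaf.map i.op).hom x) =
      (X.presheaf.map i.op).hom (t.ring V x) := by
  refine Eq.trans ?_ (t.naturality i (truncate n x))
  rw [wittMap_truncate]
  rfl

/-- Let `h` be a natural family of maps on sections with `h (r ^ q * a) = r * h a`. Then the germ
of `h a` is determined by the values of `h` on a fixed affine neighbourhood, up to a unit. -/
theorem exists_section_of_isAffineOpen (h : ∀ U : X.Opens, Γ(X, U) → Γ(X, U))
    (hnat : ∀ {U V : X.Opens} (i : U ⟶ V) (a : Γ(X, V)),
      h U ((X.presheaf.map i.op).hom a) = (X.presheaf.map i.op).hom (h V a))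
    {q : ℕ} (hq : 0 < q) (hlin : ∀ (U : X.Opens) (r a : Γ(X, U)), h U (r ^ q * a) = r * h U a)
    {U U₀ : X.Opens} (hU₀ : IsAffineOpen U₀) {x : X} (hx₀ : x ∈ U₀) (hx : x ∈ U) (a : Γ(X, U)) :
    ∃ r a₀ : Γ(X, U₀), IsUnit ((X.presheaf.germ U₀ x hx₀).hom r) ∧
      (X.presheaf.germ U₀ x hx₀).hom r ^ q * (X.presheaf.germ U x hx).hom a =
        (X.presheaf.germ U₀ x hx₀).hom a₀ ∧
      (X.presheaf.germ U₀ x hx₀).hom r * (X.presheaf.germ U x hx).hom (h U a) =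
        (X.presheaf.germ U₀ x hx₀).hom (h U₀ a₀) := by
  let := TopCat.Presheaf.algebra_section_stalk X.presheaf (⟨x, hx₀⟩ : U₀)
  have hloc := hU₀.isLocalization_stalk ⟨x, hx₀⟩
  obtain ⟨⟨b, r⟩, hb⟩ := IsLocalization.surj (hU₀.primeIdealOf ⟨x, hx₀⟩).asIdeal.primeCompl
    ((X.presheaf.germ U x hx).hom a)
  have hr : IsUnit ((X.presheaf.germ U₀ x hx₀).hom r) :=
    IsLocalization.map_units (X.presheaf.stalk x) r
  replace hb : (X.presheaf.germ U x hx).hom a * (X.presheaf.germ U₀ x hx₀).hom r =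
    (X.presheaf.germ U₀ x hx₀).hom b := hb
  obtain ⟨W, hW, i₀, i, hi⟩ : ∃ (W : X.Opens) (_ : x ∈ W) (i₀ : W ⟶ U₀) (i : W ⟶ U),
      (X.presheaf.map i₀.op).hom r ^ q * (X.presheaf.map i.op).hom a =
        (X.presheaf.map i₀.op).hom ((r : Γ(X, U₀)) ^ (q - 1) * b) := by
    let i : U ⊓ U₀ ⟶ U := homOfLE inf_le_left
    let i₀ : U ⊓ U₀ ⟶ U₀ := homOfLE inf_le_right
    obtain ⟨W, hW, j, j₀, hj⟩ := X.presheaf.germ_eq (U := U ⊓ U₀) x ⟨hx, hx₀⟩ hx₀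
      ((X.presheaf.map i.op).hom a * (X.presheaf.map i₀.op).hom r) b (by
        refine Eq.trans ?_ hb
        rw [map_mul]
        exact congr_arg₂ (· * ·) (X.presheaf.germ_res_apply i x ⟨hx, hx₀⟩ a)
          (X.presheaf.germ_res_apply i₀ x ⟨hx, hx₀⟩ _))
    have hj' : (X.presheaf.map (j ≫ i).op).hom a * (X.presheaf.map j₀.op).hom r =
        (X.presheaf.map j₀.op).hom b := by
      refine Eq.trans ?_ hj
      rw [map_mul]
      refine congr_arg₂ (· * ·) ?_ ?_
      · rw [op_comp, X.presheaf.map_comp]; rfl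
      · rw [Subsingleton.elim j₀ (j ≫ i₀), op_comp, X.presheaf.map_comp]; rfl
    refine ⟨W, hW, j₀, j ≫ i, ?_⟩
    rw [map_mul, map_pow, ← hj', ← Nat.sub_add_cancel hq, pow_succ, Nat.add_sub_cancel]
    ring
  refine ⟨r, (r : Γ(X, U₀)) ^ (q - 1) * b, hr, ?_, ?_⟩
  · rw [map_mul, map_pow, ← hb, mul_comm _ ((X.presheaf.germ U₀ x hx₀).hom _), ← mul_assoc,
      ← pow_succ, Nat.sub_add_cancel hq]
  · have h1 := congrArg (h W) hi
    rw [hlin, hnat, hnat] at h1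
    have h2 := congrArg (X.presheaf.germ W x hW).hom h1
    rw [map_mul] at h2
    have e₀ : ∀ s, (X.presheaf.germ W x hW).hom ((X.presheaf.map i₀.op).hom s) =
        (X.presheaf.germ U₀ x hx₀).hom s := X.presheaf.germ_res_apply i₀ x hW
    have e : ∀ s, (X.presheaf.germ W x hW).hom ((X.presheaf.map i.op).hom s) =
        (X.presheaf.germ U x hx).hom s := X.presheaf.germ_res_apply i x hW
    rwa [e₀, e₀, e] at h2

/-- A family of germs which is locally induced by sections is induced by a section. -/
theorem exists_section_of_germs (O : X.Opens) (s : ∀ x : X, X.presheaf.stalk x)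
    (hs : ∀ x ∈ O, ∃ (O' : X.Opens) (_ : x ∈ O') (_ : O' ≤ O) (t : Γ(X, O')),
      ∀ (y : X) (hy : y ∈ O'), (X.presheaf.germ O' y hy).hom t = s y) :
    ∃ t : Γ(X, O), ∀ (y : X) (hy : y ∈ O), (X.presheaf.germ O y hy).hom t = s y := by
  choose W hxW hWO t ht using fun x : O => hs x.1 x.2
  have hcov : O ≤ iSup W := fun x hx => TopologicalSpace.Opens.mem_iSup.2 ⟨⟨x, hx⟩, hxW _⟩
  obtain ⟨g, hg, -⟩ := X.sheaf.existsUnique_gluing' W O (fun x => homOfLE (hWO x)) hcov t (by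
    intro x y
    refine TopCat.Presheaf.section_ext X.sheaf _ _ _ fun z hz => ?_
    refine (X.presheaf.germ_res_apply _ z hz (t x)).trans
      (Eq.trans ?_ (X.presheaf.germ_res_apply _ z hz (t y)).symm)
    exact (ht x z hz.1).trans (ht y z hz.2).symm)
  refine ⟨g, fun y hy => ?_⟩
  rw [← ht ⟨y, hy⟩ y (hxW _), ← hg ⟨y, hy⟩]
  exact (X.presheaf.germ_res_apply (homOfLE (hWO ⟨y, hy⟩)) y (hxW _) g).symm

end Sections

/-! ### The product of two schemes -/

section Product

variable {p n : ℕ} [hp : Fact p.Prime] [NeZero n] {k : Type u} [Field k]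
  {X Y Z : Scheme.{u}} {f : X ⟶ Spec (CommRingCat.of k)} {g : Y ⟶ Spec (CommRingCat.of k)}
  {p₁ : Z ⟶ X} {p₂ : Z ⟶ Y}

theorem exists_isPushout_sections (H : IsPullback p₁ p₂ f g) {U : X.Opens} {V : Y.Opens}
    (hU : IsAffineOpen U) (hV : IsAffineOpen V) :
    ∃ (i : CommRingCat.of k ⟶ Γ(X, U)) (j : CommRingCat.of k ⟶ Γ(Y, V)),
      IsPushout i j (p₁.appLE U (p₁ ⁻¹ᵁ U ⊓ p₂ ⁻¹ᵁ V) inf_le_left)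
        (p₂.appLE V (p₁ ⁻¹ᵁ U ⊓ p₂ ⁻¹ᵁ V) inf_le_right) := by
  have h := (isIso_pushoutSection_iff H (US := ⊤) (UT := V) (UX := U) le_top le_top rfl).1
    (isIso_pushoutSection_of_isAffineOpen H le_top le_top rfl (isAffineOpen_top _) hV hU)
  exact ⟨_, _, h.of_iso (Scheme.ΓSpecIso _) (Iso.refl _) (Iso.refl _) (Iso.refl _)
    (f' := (Scheme.ΓSpecIso _).inv ≫ f.appLE ⊤ U le_top)
    (g' := (Scheme.ΓSpecIso _).inv ≫ g.appLE ⊤ V le_top) (by simp) (by simp) (by simp) (by simp)⟩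

theorem isAffineOpen_inf_preimage (H : IsPullback p₁ p₂ f g) {U : X.Opens} {V : Y.Opens}
    (hU : IsAffineOpen U) (hV : IsAffineOpen V) : IsAffineOpen (p₁ ⁻¹ᵁ U ⊓ p₂ ⁻¹ᵁ V) := by
  have : IsAffine _ := hU
  have : IsAffine _ := hV
  have : IsAffine _ := isAffineOpen_top (Spec (CommRingCat.of k))
  exact .of_isIso (Scheme.Hom.isPullback_resLE H (US := ⊤) (UT := V) (UX := U)
    le_top le_top rfl).isoPullback.hom

/-- The germ at `x` of the pullback of a section along a morphism. -/
theorem germ_appLE {W : Z.Opens} {U : X.Opens} (h : W ≤ p₁ ⁻¹ᵁ U) (x : Z) (hx : x ∈ W)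
    (a : Γ(X, U)) :
    (Z.presheaf.germ W x hx).hom ((p₁.appLE U W h).hom a) =
      (p₁.stalkMap x).hom ((X.presheaf.germ U (p₁ x) (h hx)).hom a) := by
  refine Eq.trans ?_ (p₁.germ_stalkMap_apply U x (h hx) a).symm
  exact Z.presheaf.germ_res_apply (homOfLE h) x hx (p₁.app U a)

/-- The compatibility of a quasi-`F`-splitting of the local ring of `Z` at `x` with the splittings
of `X` and `Y`: it sends `V ^ m [c ^ (p ^ (m + 1)) * a * b]`, i.e. formally
`F [c] * [a ^ (1 / p ^ m)] * V ^ m [b]`, to `c * σ ^ (m + 1) a * τ (V ^ m [b])`. -/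
def IsProductAt (s : FSplitting p X) (t : QuasiFSplitting p n Y) (p₁ : Z ⟶ X) (p₂ : Z ⟶ Y) (x : Z)
    (Φ : RingQuasiFSplitting p n (Z.presheaf.stalk x)) : Prop :=
  ∀ (U : X.Opens) (hU : p₁ x ∈ U) (V : Y.Opens) (hV : p₂ x ∈ V) (m : ℕ) (a : Γ(X, U))
    (b : Γ(Y, V)) (c : Z.presheaf.stalk x),
    Φ (verschiebung^[m] (teichmuller p (c ^ p ^ (m + 1) *
      ((p₁.stalkMap x).hom ((X.presheaf.germ U (p₁ x) hU).hom a) *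
        (p₂.stalkMap x).hom ((Y.presheaf.germ V (p₂ x) hV).hom b))))) =
    c * ((p₁.stalkMap x).hom ((X.presheaf.germ U (p₁ x) hU).hom
        ((s.ring U).toAddMonoidHom^[m + 1] a)) *
      (p₂.stalkMap x).hom ((Y.presheaf.germ V (p₂ x) hV).hom
        (t.ring V (verschiebung^[m] (teichmuller p b)))))

/-- The local ring at `x` is a localization of `A ⊗ B` for affine neighbourhoods `Spec A` and
`Spec B` of the images of `x`, which gives a splitting compatible with sections over these two
neighbourhoods, and hence with sections over all others. -/
theorem exists_isProductAt [CharP k p] [PerfectField k] (H : IsPullback p₁ p₂ f g)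
    (hX : IsFpScheme p X) (hY : IsFpScheme p Y) (s : FSplitting p X) (t : QuasiFSplitting p n Y)
    (x : Z) : ∃ Φ, IsProductAt s t p₁ p₂ x Φ := by
  obtain ⟨U₀, hU₀, hxU₀, -⟩ := exists_isAffineOpen_mem_and_subset
    (show p₁ x ∈ (⊤ : X.Opens) from trivial)
  obtain ⟨V₀, hV₀, hxV₀, -⟩ := exists_isAffineOpen_mem_and_subset
    (show p₂ x ∈ (⊤ : Y.Opens) from trivial)
  obtain ⟨i, j, h⟩ := exists_isPushout_sections H hU₀ hV₀
  have hxW : x ∈ p₁ ⁻¹ᵁ U₀ ⊓ p₂ ⁻¹ᵁ V₀ := ⟨hxU₀, hxV₀⟩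
  have hW : IsAffineOpen (p₁ ⁻¹ᵁ U₀ ⊓ p₂ ⁻¹ᵁ V₀) :=
    isAffineOpen_inf_preimage H hU₀ hV₀
  have hZ := hX.of_hom p₁
  have := hX.charP hxU₀
  have := nontrivial_of_mem hxV₀
  have := hZ.charP hxW
  have := hZ.charP_stalk x
  have := hY.charP_stalk (p₂ x)
  obtain ⟨Φ₀, hΦ₀⟩ := RingQuasiFSplitting.exists_of_isPushout h (s.ring U₀) (t.ring V₀)
  let := TopCat.Presheaf.algebra_section_stalk Z.presheaf (⟨x, hxW⟩ : ↥(p₁ ⁻¹ᵁ U₀ ⊓ p₂ ⁻¹ᵁ V₀))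
  have hloc := hW.isLocalization_stalk ⟨x, hxW⟩
  obtain ⟨Φ, hΦ⟩ := RingQuasiFSplitting.exists_localization
    (R := Z.presheaf.stalk x) (hW.primeIdealOf ⟨x, hxW⟩).asIdeal.primeCompl Φ₀
  refine ⟨Φ, ?_⟩
  have hchart : ∀ (m : ℕ) (a : Γ(X, U₀)) (b : Γ(Y, V₀)) (c : Z.presheaf.stalk x),
      Φ (verschiebung^[m] (teichmuller p (c ^ p ^ (m + 1) *
        ((p₁.stalkMap x).hom ((X.presheaf.germ U₀ (p₁ x) hxU₀).hom a) *
          (p₂.stalkMap x).hom ((Y.presheaf.germ V₀ (p₂ x) hxV₀).hom b))))) =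
      c * ((p₁.stalkMap x).hom ((X.presheaf.germ U₀ (p₁ x) hxU₀).hom
          ((s.ring U₀).toAddMonoidHom^[m + 1] a)) *
        (p₂.stalkMap x).hom ((Y.presheaf.germ V₀ (p₂ x) hxV₀).hom
          (t.ring V₀ (verschiebung^[m] (teichmuller p b))))) := by
    intro m a b c
    have h1 := hΦ (verschiebung^[m] (teichmuller p ((p₁.appLE U₀ _ inf_le_left).hom a *
      (p₂.appLE V₀ _ inf_le_right).hom b)))
    rw [hΦ₀ m a b, map_iterate_verschiebung, map_teichmuller] at h1
    change Φ (verschiebung^[m] (teichmuller p ((Z.presheaf.germ _ x hxW).hom _))) =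
      (Z.presheaf.germ _ x hxW).hom _ at h1
    rw [map_mul (Z.presheaf.germ _ x hxW).hom, map_mul (Z.presheaf.germ _ x hxW).hom, germ_appLE,
      germ_appLE, germ_appLE, germ_appLE] at h1
    rw [Φ.apply_iterate_verschiebung_mul (hZ.cast_stalk_eq_zero x), h1]
  intro U hU V hV m a b c
  -- Replace `a` and `b` by sections over `U₀` and `V₀`, up to units.
  obtain ⟨r, a₀, hr, ha, ha'⟩ := exists_section_of_isAffineOpen
    (fun U a => (s.ring U).toAddMonoidHom^[m + 1] a) (s.iterate_naturality (m + 1))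
    (pow_pos hp.out.pos (m + 1)) (fun U => (s.ring U).iterate_map_pow_mul (m + 1)) hU₀ hxU₀ hU a
  obtain ⟨r', b₀, hr', hb, hb'⟩ := exists_section_of_isAffineOpen
    (fun V b => t.ring V (verschiebung^[m] (teichmuller p b)))
    (fun i b => by
      rw [← t.ring_naturality, map_iterate_verschiebung, map_teichmuller])
    (pow_pos hp.out.pos (m + 1))
    (fun V r b => (t.ring V).apply_iterate_verschiebung_mul (hY.cast_eq_zero V) m r b)
    hV₀ hxV₀ hV b
  obtain ⟨v, hv⟩ := (hr.map (p₁.stalkMap x).hom).exists_right_inv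
  obtain ⟨v', hv'⟩ := (hr'.map (p₂.stalkMap x).hom).exists_right_inv
  have h1 := hchart m a₀ b₀ (c * v * v')
  rw [← ha, ← hb, ← ha', ← hb'] at h1
  simp only [map_mul (p₁.stalkMap x).hom, map_mul (p₂.stalkMap x).hom,
    map_pow (p₁.stalkMap x).hom, map_pow (p₂.stalkMap x).hom] at h1
  generalize (p₁.stalkMap x).hom ((X.presheaf.germ U (p₁ x) hU).hom a) = A at h1 ⊢
  generalize (p₂.stalkMap x).hom ((Y.presheaf.germ V (p₂ x) hV).hom b) = B at h1 ⊢
  generalize (p₁.stalkMap x).hom ((X.presheaf.germ U₀ (p₁ x) hxU₀).hom r) = R at h1 hv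
  generalize (p₂.stalkMap x).hom ((Y.presheaf.germ V₀ (p₂ x) hxV₀).hom r') = R' at h1 hv'
  refine Eq.trans ?_ (h1.trans ?_)
  · refine congrArg (fun z => Φ (verschiebung^[m] (teichmuller p z))) ?_
    calc _ = c ^ p ^ (m + 1) * (A * B) * ((R * v) * (R' * v')) ^ p ^ (m + 1) := by
          rw [hv, hv', mul_one, one_pow, mul_one]
      _ = _ := by simp only [mul_pow]; ring
  · generalize (p₁.stalkMap x).hom _ = A'
    generalize (p₂.stalkMap x).hom _ = B'
    linear_combination (c * A' * B' * R' * v') * hv + (c * A' * B') * hv'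

/-- The sections over a basic open subset of an affine chart of the product are sums of elements
`c ^ q * (a * b)`, where `a` and `b` are sections over the factors, since denominators can be taken
to be `q`-th powers. -/
theorem closure_sections_basicOpen (H : IsPullback p₁ p₂ f g) {U : X.Opens} {V : Y.Opens}
    (hU : IsAffineOpen U) (hV : IsAffineOpen V) (h : Γ(Z, p₁ ⁻¹ᵁ U ⊓ p₂ ⁻¹ᵁ V)) {q : ℕ}
    (hq : 0 < q) :
    AddSubgroup.closure {d : Γ(Z, Z.basicOpen h) | ∃ c a b, d = c ^ q *
      ((p₁.appLE U (Z.basicOpen h) ((Z.basicOpen_le h).trans inf_le_left)).hom a *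
        (p₂.appLE V (Z.basicOpen h) ((Z.basicOpen_le h).trans inf_le_right)).hom b)} = ⊤ := by
  refine eq_top_iff.2 fun d _ => ?_
  have := (isAffineOpen_inf_preimage H hU hV).isLocalization_basicOpen h
  obtain ⟨⟨e, r⟩, hd⟩ := IsLocalization.surj (Submonoid.powers h) d
  obtain ⟨u, hu⟩ := (IsLocalization.map_units Γ(Z, Z.basicOpen h) r).exists_right_inv
  let φ := algebraMap Γ(Z, p₁ ⁻¹ᵁ U ⊓ p₂ ⁻¹ᵁ V) Γ(Z, Z.basicOpen h)
  -- `d = e / r = (1 / r) ^ q * (r ^ (q - 1) * e)`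
  have hd' : d = u ^ q * φ (r ^ (q - 1) * e) := by
    rw [map_mul, map_pow, ← hd]
    calc d = d * (φ r * u) ^ q := by rw [hu, one_pow, mul_one]
      _ = d * φ r ^ (q - 1 + 1) * u ^ q := by rw [Nat.sub_add_cancel hq]; ring
      _ = _ := by rw [pow_succ]; ring
  rw [hd']
  clear hd' hd
  obtain ⟨i, j, hij⟩ := exists_isPushout_sections H hU hV
  have hy : (r : Γ(Z, p₁ ⁻¹ᵁ U ⊓ p₂ ⁻¹ᵁ V)) ^ (q - 1) * e ∈ (⊤ : AddSubgroup _) := trivial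
  rw [← closure_mul_eq_top_of_isPushout hij] at hy
  generalize (r : Γ(Z, p₁ ⁻¹ᵁ U ⊓ p₂ ⁻¹ᵁ V)) ^ (q - 1) * e = y at hy
  induction hy using AddSubgroup.closure_induction with
  | mem y hy =>
    obtain ⟨a, b, rfl⟩ := hy
    refine AddSubgroup.subset_closure ⟨u, a, b, ?_⟩
    rw [map_mul]
    have h1 := congr($(p₁.appLE_map (U := U) (V := p₁ ⁻¹ᵁ U ⊓ p₂ ⁻¹ᵁ V) inf_le_left
      (homOfLE (Z.basicOpen_le h)).op).hom a)
    have h2 := congr($(p₂.appLE_map (U := V) (V := p₁ ⁻¹ᵁ U ⊓ p₂ ⁻¹ᵁ V) inf_le_right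
      (homOfLE (Z.basicOpen_le h)).op).hom b)
    rw [← h1, ← h2]
    rfl
  | zero => rw [map_zero, mul_zero]; exact zero_mem _
  | add x y _ _ hx hy => rw [map_add, mul_add]; exact add_mem hx hy
  | neg x _ hx => rw [map_neg, mul_neg]; exact neg_mem hx

/-- The product splittings of the local rings send the germs of a section of `W_n 𝒪_Z` to germs
which locally come from a section of `𝒪_Z`. -/
theorem exists_local_section (H : IsPullback p₁ p₂ f g) (s : FSplitting p X)
    (t : QuasiFSplitting p n Y) (Φ : ∀ x : Z, RingQuasiFSplitting p n (Z.presheaf.stalk x))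
    (hΦ : ∀ x, IsProductAt s t p₁ p₂ x (Φ x)) {O : Z.Opens} (w : WittVector p Γ(Z, O)) {x : Z}
    (hx : x ∈ O) :
    ∃ (O' : Z.Opens) (_ : x ∈ O') (hO : O' ≤ O) (v : Γ(Z, O')), ∀ (y : Z) (hy : y ∈ O'),
      (Z.presheaf.germ O' y hy).hom v =
        Φ y (WittVector.map (Z.presheaf.germ O y (hO hy)).hom w) := by
  obtain ⟨U, hU, hxU, -⟩ := exists_isAffineOpen_mem_and_subset
    (show p₁ x ∈ (⊤ : X.Opens) from trivial)
  obtain ⟨V, hV, hxV, -⟩ := exists_isAffineOpen_mem_and_subset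
    (show p₂ x ∈ (⊤ : Y.Opens) from trivial)
  obtain ⟨h, hO, hxh⟩ := (isAffineOpen_inf_preimage H hU hV).exists_basicOpen_le ⟨x, hx⟩
    (show x ∈ p₁ ⁻¹ᵁ U ⊓ p₂ ⁻¹ᵁ V from ⟨hxU, hxV⟩)
  refine ⟨Z.basicOpen h, hxh, hO, ?_⟩
  have hres : ∀ (y : Z) (hy : y ∈ Z.basicOpen h),
      WittVector.map (Z.presheaf.germ O y (hO hy)).hom w =
        WittVector.map (Z.presheaf.germ (Z.basicOpen h) y hy).hom
          (WittVector.map (Z.presheaf.map (homOfLE hO).op).hom w) := by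
    intro y hy
    ext m
    exact (Z.presheaf.germ_res_apply (homOfLE hO) y hy (w.coeff m)).symm
  obtain ⟨g, hg, hwg⟩ := exists_mem_closure_iterate_verschiebung _ (fun m =>
    closure_sections_basicOpen H hU hV h (pow_pos hp.out.pos (m + 1))) n
    (WittVector.map (Z.presheaf.map (homOfLE hO).op).hom w)
  suffices ∃ v : Γ(Z, Z.basicOpen h), ∀ (y : Z) (hy : y ∈ Z.basicOpen h),
      (Z.presheaf.germ _ y hy).hom v =
        Φ y (WittVector.map (Z.presheaf.germ (Z.basicOpen h) y hy).hom g) by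
    obtain ⟨v, hv⟩ := this
    refine ⟨v, fun y hy => ?_⟩
    rw [hv, hres y hy, eq_comm, ← sub_eq_zero, ← map_sub, ← map_sub]
    exact (Φ y).apply_of_truncate (truncate_map_eq_zero _ hwg)
  clear hwg hres
  induction hg using AddSubgroup.closure_induction with
  | mem z hz =>
    obtain ⟨m, _, ⟨c, a, b, rfl⟩, rfl⟩ := hz
    refine ⟨c * ((p₁.appLE U (Z.basicOpen h) ((Z.basicOpen_le h).trans inf_le_left)).hom
        ((s.ring U).toAddMonoidHom^[m + 1] a) *
      (p₂.appLE V (Z.basicOpen h) ((Z.basicOpen_le h).trans inf_le_right)).hom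
        (t.ring V (verschiebung^[m] (teichmuller p b)))), fun y hy => ?_⟩
    simp only [map_iterate_verschiebung, map_teichmuller, map_mul, map_pow, germ_appLE]
    have := hΦ y U ((Z.basicOpen_le h).trans inf_le_left hy) V
      ((Z.basicOpen_le h).trans inf_le_right hy) m a b ((Z.presheaf.germ _ y hy).hom c)
    simp only [map_mul, map_pow] at this
    exact this.symm
  | zero => exact ⟨0, fun y hy => by simp⟩
  | add z z' _ _ hz hz' =>
    obtain ⟨v, hv⟩ := hz
    obtain ⟨v', hv'⟩ := hz'
    exact ⟨v + v', fun y hy => by rw [map_add, hv, hv', map_add, map_add]⟩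
  | neg z _ hz =>
    obtain ⟨v, hv⟩ := hz
    exact ⟨-v, fun y hy => by rw [map_neg, hv, map_neg, map_neg]⟩

/-- Splittings of the local rings glue to a splitting of the scheme if they send sections of
`W_n 𝒪_Z` locally to sections of `𝒪_Z`. -/
theorem nonempty_quasiFSplitting_of_stalks (hZ : IsFpScheme p Z)
    (Φ : ∀ x : Z, RingQuasiFSplitting p n (Z.presheaf.stalk x))
    (hΦ : ∀ (O : Z.Opens) (w : WittVector p Γ(Z, O)) (x : Z), x ∈ O →
      ∃ (O' : Z.Opens) (_ : x ∈ O') (hO : O' ≤ O) (v : Γ(Z, O')), ∀ (y : Z) (hy : y ∈ O'),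
      (Z.presheaf.germ O' y hy).hom v =
        Φ y (WittVector.map (Z.presheaf.germ O y (hO hy)).hom w)) :
    Nonempty (QuasiFSplitting p n Z) := by
  have key : ∀ (O : Z.Opens) (w : WittVector p Γ(Z, O)), ∃ v : Γ(Z, O), ∀ (y : Z) (hy : y ∈ O),
      (Z.presheaf.germ O y hy).hom v = Φ y (WittVector.map (Z.presheaf.germ O y hy).hom w) := by
    intro O w
    classical
    obtain ⟨v, hv⟩ := exists_section_of_germs O
      (fun y => if hy : y ∈ O then Φ y (WittVector.map (Z.presheaf.germ O y hy).hom w) else 0)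
      (fun x hx => by
        obtain ⟨O', hx', hO, v, hv⟩ := hΦ O w x hx
        exact ⟨O', hx', hO, v, fun y hy => by rw [hv, dif_pos (hO hy)]⟩)
    exact ⟨v, fun y hy => by rw [hv, dif_pos hy]⟩
  choose F hF using key
  have ext : ∀ (O : Z.Opens) (v v' : Γ(Z, O)), (∀ (y : Z) (hy : y ∈ O),
      (Z.presheaf.germ O y hy).hom v = (Z.presheaf.germ O y hy).hom v') → v = v' :=
    fun O v v' h => TopCat.Presheaf.section_ext Z.sheaf O v v' h
  have hG : ∀ O : Z.Opens, ∃ G : TruncatedWittVector p n Γ(Z, O) →+ Γ(Z, O),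
      ∀ (w : WittVector p Γ(Z, O)) (y : Z) (hy : y ∈ O),
        (Z.presheaf.germ O y hy).hom (G (truncate n w)) =
          Φ y (WittVector.map (Z.presheaf.germ O y hy).hom w) := by
    intro O
    have hout : ∀ (w : WittVector p Γ(Z, O)) (y : Z) (hy : y ∈ O),
        (Z.presheaf.germ O y hy).hom (F O (truncate n w).out) =
          Φ y (WittVector.map (Z.presheaf.germ O y hy).hom w) := by
      intro w y hy
      rw [hF, ← sub_eq_zero, ← map_sub, ← map_sub]
      refine (Φ y).apply_of_truncate (truncate_map_eq_zero _ ?_)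
      rw [map_sub, sub_eq_zero]
      exact TruncatedWittVector.truncateFun_out _
    refine ⟨AddMonoidHom.mk' (fun x => F O x.out) fun x x' => ?_, hout⟩
    obtain ⟨x, rfl⟩ := truncate_surjective (p := p) n _ x
    obtain ⟨x', rfl⟩ := truncate_surjective (p := p) n _ x'
    refine ext _ _ _ fun y hy => ?_
    rw [← map_add, map_add (Z.presheaf.germ O y hy).hom, hout, hout, hout, map_add, map_add]
  choose G hG using hG
  have hfrob : ∀ (O : Z.Opens) (a b : WittVector p Γ(Z, O)) (y : Z) (hy : y ∈ O),
      (Z.presheaf.germ O y hy).hom (G O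
        (wittFrobenius p n (truncate n a) * truncate n b)) =
      (Z.presheaf.germ O y hy).hom (a.coeff 0) *
        Φ y (WittVector.map (Z.presheaf.germ O y hy).hom b) := by
    intro O a b y hy
    have := hZ.charP hy
    have := hZ.charP_stalk y
    have hmap : WittVector.map (Z.presheaf.germ O y hy).hom (frobenius a) =
        frobenius (WittVector.map (Z.presheaf.germ O y hy).hom a) := by
      ext m
      rw [map_coeff, coeff_frobenius_charP, coeff_frobenius_charP, map_coeff, map_pow]
    rw [wittFrobenius_truncate p n (hZ.cast_eq_zero O), ← map_mul, hG, map_mul, hmap,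
      (Φ y).frobenius_mul, map_coeff]
  refine ⟨⟨G, fun {O O'} i x => ?_, fun O a b => ?_, fun O a => ?_⟩⟩
  · obtain ⟨x, rfl⟩ := truncate_surjective (p := p) n _ x
    refine ext _ _ _ fun y hy => ?_
    rw [wittMap_truncate, hG]
    refine Eq.trans ?_ (Z.presheaf.germ_res_apply i y hy _).symm
    refine Eq.trans ?_ (hG O' x y (i.le hy)).symm
    refine congrArg (Φ y) ?_
    ext m
    exact Z.presheaf.germ_res_apply i y hy (x.coeff m)
  · obtain ⟨a, rfl⟩ := truncate_surjective (p := p) n _ a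
    obtain ⟨b, rfl⟩ := truncate_surjective (p := p) n _ b
    refine ext _ _ _ fun y hy => ?_
    rw [hfrob, map_mul, hG, coeff_truncate, Fin.val_zero]
  · obtain ⟨a, rfl⟩ := truncate_surjective (p := p) n _ a
    refine ext _ _ _ fun y hy => ?_
    have := hfrob O a 1 y hy
    rw [map_one, mul_one, map_one, (Φ y).apply_one, mul_one] at this
    rw [this, coeff_truncate, Fin.val_zero]

end Product

end QuasiFSplit

theorem mainTheorem1 (p : ℕ) [Fact p.Prime] (k : Type u) [Field k] [CharP k p] [PerfectField k]
    (X Y : Scheme.{u}) (f : X ⟶ Spec (CommRingCat.of k)) (g : Y ⟶ Spec (CommRingCat.of k))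
    (n : ℕ) [NeZero n]
    (hX : QuasiFSplit.IsFSplit p X) (hY : QuasiFSplit.IsQuasiFSplit p n Y) :
    QuasiFSplit.IsQuasiFSplit p n (Limits.pullback f g) := by
  obtain ⟨hX, ⟨s⟩⟩ := hX
  obtain ⟨hY, ⟨t⟩⟩ := hY
  have H := IsPullback.of_hasPullback f g
  have hZ := hX.of_hom (Limits.pullback.fst f g)
  choose Φ hΦ using QuasiFSplit.exists_isProductAt H hX hY s t
  exact ⟨hZ, QuasiFSplit.nonempty_quasiFSplitting_of_stalks hZ Φ fun O w x hx =>
    QuasiFSplit.exists_local_section H s t Φ hΦ w hx⟩
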